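/- Let $X\in\mathbb R^{n\times d}$, $y\in\mathbb R^n$ and $m_1\ge 0$ an integer, and let $(\cdot)_+$ be the entrywise ReLU. Consider the training problem \[ \min_{m,\{W_{1i},w_{2i},\alpha_i\}_{i=1}^m}\ \frac13\sum_{i=1}^m\left(\|W_{1i}\|_F^3+\|w_{2i}\|_2^3+|\alpha_i|^3\right)\quad\text{s.t.}\quad \sum_{i=1}^m((XW_{1i})_+w_{2i})_+\alpha_i=y, \] over all $m\in\mathbb N$, $W_{1i}\in\mathbb R^{d\times m_1}$, $w_{2i}\in\mathbb R^{m_1}$, $\alpha_i\in\mathbb R$. The direction of a nonzero vector $v$ is $v/\|v\|_2$. A dual optimum is a maximizer $\nu^*\in\mathbb R^n$ of $\nu^Ty$ over all $\nu$ such that $|\nu^T((XW_1)_+w_2)_+|\le 1$ whenever $\|W_1\|_F\le 1$ and $\|w_2\|_2\le 1$. (1) The set of directions of the nonzero columns of the matrices $W_{1i}^*$, over all optimal solutions $(m,\{W_{1i}^*,w_{2i}^*,\alpha_i^*\}_{i=1}^m)$ and all $i$, is finite. (2) These directions are determined by the dual problem \[ \max_{\|W_1\|_F\le 1,\ \|w_2\|_2\le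 1}\left|(\nu^*)^T((XW_1)_+w_2)_+\right| \qquad (\ast) \] in the following sense. If the training problem is feasible, a dual optimum exists. For every dual optimum $\nu^*$ and every optimal solution, each $i$ satisfies either $W_{1i}^*=0$, $w_{2i}^*=0$, $\alpha_i^*=0$, or $W_{1i}^*\neq0$, $w_{2i}^*\ne0$ and $\left(W_{1i}^*/\|W_{1i}^*\|_F,\ w_{2i}^*/\|w_{2i}^*\|_2\right)$ is a maximizer of $(\ast)$. Hence every direction in (1) is the direction of a nonzero column of the $W_1$-part of a maximizer of $(\ast)$; and if $y\neq0$, the set of directions of the nonzero columns of the $W_1$-parts of all maximizers of $(\ast)$ is finite. -/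

import Mathlib

open scoped Matrix Matrix.Norms.Frobenius

noncomputable section

namespace ParallelReLU

/-- The scalar ReLU `(t)₊`. -/
def relu (t : ℝ) : ℝ := max t 0

/-- The parameters `(W₁, w₂, α)` of one branch of a parallel three-layer network, with input
dimension `d` and inner width `m₁`. The norm of `W₁` is the Frobenius norm (opened above), the norm
of `w₂` is the Euclidean norm. -/
structure Branch (d m₁ : ℕ) where
  W₁ : Matrix (Fin d) (Fin m₁) ℝ
  w₂ : EuclideanSpace ℝ (Fin m₁)
  α : ℝ

variable {n d m₁ : ℕ}

/-- The vector `((X W₁)₊ w₂)₊ ∈ ℝⁿ`. -/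
def feature (X : Matrix (Fin n) (Fin d) ℝ) (W₁ : Matrix (Fin d) (Fin m₁) ℝ)
    (w₂ : EuclideanSpace ℝ (Fin m₁)) : Fin n → ℝ :=
  fun a => relu (((X * W₁).map relu *ᵥ w₂.ofLp) a)

/-- The network with `m` branches `θ` interpolates the labels: `∑ᵢ ((X W₁ᵢ)₊ w₂ᵢ)₊ αᵢ = y`. -/
def Interpolates (X : Matrix (Fin n) (Fin d) ℝ) (y : Fin n → ℝ) {m : ℕ}
    (θ : Fin m → Branch d m₁) : Prop :=
  ∑ i, (θ i).α • feature X (θ i).W₁ (θ i).w₂ = y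

/-- The objective `(1/3) ∑ᵢ (‖W₁ᵢ‖_F³ + ‖w₂ᵢ‖₂³ + |αᵢ|³)`. -/
def cost {m : ℕ} (θ : Fin m → Branch d m₁) : ℝ :=
  (1 / 3) * ∑ i, (‖(θ i).W₁‖ ^ 3 + ‖(θ i).w₂‖ ^ 3 + |(θ i).α| ^ 3)

/-- `θ` solves the training problem, in which the number of branches is minimized over as well. -/
def IsOptimal (X : Matrix (Fin n) (Fin d) ℝ) (y : Fin n → ℝ) {m : ℕ}
    (θ : Fin m → Branch d m₁) : Prop :=
  Interpolates X y θ ∧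
    ∀ (m' : ℕ) (θ' : Fin m' → Branch d m₁), Interpolates X y θ' → cost θ ≤ cost θ'

/-- The `k`-th column of a matrix, as a Euclidean vector. -/
def column (W : Matrix (Fin d) (Fin m₁) ℝ) (k : Fin m₁) : EuclideanSpace ℝ (Fin d) :=
  WithLp.toLp 2 (fun j => W j k)

/-- The direction of a vector; it is used for nonzero vectors only. -/
def direction (v : EuclideanSpace ℝ (Fin d)) : EuclideanSpace ℝ (Fin d) := ‖v‖⁻¹ • v

/-- The directions of the nonzero columns of all first-layer weights in all optimal networks,
over all numbers of branches. -/
def optimalDirections (m₁ : ℕ) (X : Matrix (Fin n) (Fin d) ℝ) (y : Fin n → ℝ) :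
    Set (EuclideanSpace ℝ (Fin d)) :=
  {u | ∃ (m : ℕ) (θ : Fin m → Branch d m₁), IsOptimal X y θ ∧
    ∃ (i : Fin m) (k : Fin m₁), column (θ i).W₁ k ≠ 0 ∧ u = direction (column (θ i).W₁ k)}

/-- Feasibility for the dual of the training problem: `|νᵀ((X W₁)₊ w₂)₊| ≤ 1` on the unit balls. -/
def DualFeasible (m₁ : ℕ) (X : Matrix (Fin n) (Fin d) ℝ) (ν : Fin n → ℝ) : Prop :=
  ∀ (W₁ : Matrix (Fin d) (Fin m₁) ℝ) (w₂ : EuclideanSpace ℝ (Fin m₁)),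
    ‖W₁‖ ≤ 1 → ‖w₂‖ ≤ 1 → |ν ⬝ᵥ feature X W₁ w₂| ≤ 1

/-- `ν` is a dual optimum: it maximizes `νᵀ y` over the dual feasible vectors. -/
def IsDualOptimal (m₁ : ℕ) (X : Matrix (Fin n) (Fin d) ℝ) (y ν : Fin n → ℝ) : Prop :=
  DualFeasible m₁ X ν ∧ ∀ ν' : Fin n → ℝ, DualFeasible m₁ X ν' → ν' ⬝ᵥ y ≤ ν ⬝ᵥ y

/-- `(W₁, w₂)` maximizes `|νᵀ((X W₁)₊ w₂)₊|` over `‖W₁‖_F ≤ 1`, `‖w₂‖₂ ≤ 1`. -/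
def IsMaximizer (X : Matrix (Fin n) (Fin d) ℝ) (ν : Fin n → ℝ)
    (W₁ : Matrix (Fin d) (Fin m₁) ℝ) (w₂ : EuclideanSpace ℝ (Fin m₁)) : Prop :=
  ‖W₁‖ ≤ 1 ∧ ‖w₂‖ ≤ 1 ∧
    ∀ (W₁' : Matrix (Fin d) (Fin m₁) ℝ) (w₂' : EuclideanSpace ℝ (Fin m₁)),
      ‖W₁'‖ ≤ 1 → ‖w₂'‖ ≤ 1 → |ν ⬝ᵥ feature X W₁' w₂'| ≤ |ν ⬝ᵥ feature X W₁ w₂|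

/-- The directions of the nonzero columns of the `W₁`-parts of all maximizers. -/
def maximizerDirections (m₁ : ℕ) (X : Matrix (Fin n) (Fin d) ℝ) (ν : Fin n → ℝ) :
    Set (EuclideanSpace ℝ (Fin d)) :=
  {u | ∃ (W₁ : Matrix (Fin d) (Fin m₁) ℝ) (w₂ : EuclideanSpace ℝ (Fin m₁)),
    IsMaximizer X ν W₁ w₂ ∧ ∃ k : Fin m₁, column W₁ k ≠ 0 ∧ u = direction (column W₁ k)}

end ParallelReLU

end

namespace ParallelReLU

variable {n d m₁ : ℕ}

/-! By AM-GM the cubic cost dominates `pathCost`, with equality only when the three norms in each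
branch agree, and homogeneity of the ReLU lets rescaled layers attain it. Training thus computes the
gauge `variationNorm`, and Hahn–Banach supplies a dual vector attaining it
(`exists_dualFeasible_eq_variationNorm`). Equality throughout the duality chain forces every nonzero
branch, once normalized, to be a maximizer (`IsOptimal.branch_eq_zero_or_isMaximizer`).

For finiteness, let two maximizers of value `v > 0` have equal sign patterns. All ReLUs are then
additive on them, so the columns `r k = |w k| • column W k + |w' k| • column W' k` define a merged
branch of value `2 * v` with squared layer norms `∑ k, ‖r k‖`. Maximality gives `2 ≤ ∑ k, ‖r k‖`,
while the triangle inequality and AM-GM give `∑ k, ‖r k‖ ≤ 2`. Equality makes corresponding nonzero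
columns positively parallel, so sign pattern and column index determine the direction. -/

/-! ### Homogeneity of the features -/

theorem relu_nonneg (t : ℝ) : 0 ≤ relu t := le_max_right _ _

theorem relu_mul_of_nonneg {c : ℝ} (hc : 0 ≤ c) (t : ℝ) : relu (c * t) = c * relu t := by
  unfold relu
  rw [mul_max_of_nonneg _ _ hc, mul_zero]

theorem relu_le_abs (t : ℝ) : relu t ≤ |t| := max_le (le_abs_self t) (abs_nonneg t)

/-- The ReLU is additive on pairs of numbers of the same sign. -/
theorem relu_add {s t : ℝ} (h : (0 ≤ s ∧ 0 ≤ t) ∨ (s ≤ 0 ∧ t ≤ 0)) :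
    relu (s + t) = relu s + relu t := by
  unfold relu
  rcases h with ⟨hs, ht⟩ | ⟨hs, ht⟩
  · rw [max_eq_left hs, max_eq_left ht, max_eq_left (add_nonneg hs ht)]
  · rw [max_eq_right hs, max_eq_right ht, max_eq_right (add_nonpos hs ht), add_zero]

/-- The input of the outer ReLU in the network, at one data point. -/
def preactivation (X : Matrix (Fin n) (Fin d) ℝ) (W₁ : Matrix (Fin d) (Fin m₁) ℝ)
    (w₂ : EuclideanSpace ℝ (Fin m₁)) (a : Fin n) : ℝ :=
  ∑ k, relu ((X * W₁) a k) * w₂ k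

theorem feature_apply (X : Matrix (Fin n) (Fin d) ℝ) (W₁ : Matrix (Fin d) (Fin m₁) ℝ)
    (w₂ : EuclideanSpace ℝ (Fin m₁)) (a : Fin n) :
    feature X W₁ w₂ a = relu (preactivation X W₁ w₂ a) := rfl

theorem feature_smul_left (X : Matrix (Fin n) (Fin d) ℝ) (W₁ : Matrix (Fin d) (Fin m₁) ℝ)
    (w₂ : EuclideanSpace ℝ (Fin m₁)) {c : ℝ} (hc : 0 ≤ c) :
    feature X (c • W₁) w₂ = c • feature X W₁ w₂ := by
  funext a
  rw [Pi.smul_apply, smul_eq_mul, feature_apply, feature_apply, ← relu_mul_of_nonneg hc]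
  congr 1
  simp only [preactivation, Finset.mul_sum, Matrix.mul_smul, Matrix.smul_apply, smul_eq_mul,
    relu_mul_of_nonneg hc, mul_assoc]

theorem feature_smul_right (X : Matrix (Fin n) (Fin d) ℝ) (W₁ : Matrix (Fin d) (Fin m₁) ℝ)
    (w₂ : EuclideanSpace ℝ (Fin m₁)) {c : ℝ} (hc : 0 ≤ c) :
    feature X W₁ (c • w₂) = c • feature X W₁ w₂ := by
  funext a
  rw [Pi.smul_apply, smul_eq_mul, feature_apply, feature_apply, ← relu_mul_of_nonneg hc]
  congr 1
  simp only [preactivation, Finset.mul_sum, PiLp.smul_apply, smul_eq_mul, mul_left_comm]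

theorem feature_zero_left (X : Matrix (Fin n) (Fin d) ℝ) (w₂ : EuclideanSpace ℝ (Fin m₁)) :
    feature X 0 w₂ = 0 := by
  simpa using feature_smul_left X 0 w₂ le_rfl

theorem feature_zero_right (X : Matrix (Fin n) (Fin d) ℝ) (W₁ : Matrix (Fin d) (Fin m₁) ℝ) :
    feature X W₁ 0 = 0 := by
  simpa using feature_smul_right X W₁ 0 le_rfl

theorem norm_inv_norm_smul_le_one {E : Type*} [NormedAddCommGroup E] [NormedSpace ℝ E] (x : E) :
    ‖‖x‖⁻¹ • x‖ ≤ 1 := by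
  rw [norm_smul, norm_inv, norm_norm]
  exact inv_mul_le_one

/-- Every feature is the product of the norms times a feature of unit-ball weights. -/
theorem feature_eq_norm_smul (X : Matrix (Fin n) (Fin d) ℝ) (W₁ : Matrix (Fin d) (Fin m₁) ℝ)
    (w₂ : EuclideanSpace ℝ (Fin m₁)) :
    feature X W₁ w₂ = (‖W₁‖ * ‖w₂‖) • feature X (‖W₁‖⁻¹ • W₁) (‖w₂‖⁻¹ • w₂) := by
  rcases eq_or_ne W₁ 0 with rfl | hW
  · simp [feature_zero_left]
  rcases eq_or_ne w₂ 0 with rfl | hw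
  · simp [feature_zero_right]
  have hW' := norm_ne_zero_iff.2 hW
  have hw' := norm_ne_zero_iff.2 hw
  rw [feature_smul_left _ _ _ (inv_nonneg.2 (norm_nonneg _)),
    feature_smul_right _ _ _ (inv_nonneg.2 (norm_nonneg _)), smul_smul, smul_smul]
  rw [show ‖W₁‖ * ‖w₂‖ * ‖W₁‖⁻¹ * ‖w₂‖⁻¹ = 1 by field_simp, one_smul]

theorem abs_dotProduct_feature_le {X : Matrix (Fin n) (Fin d) ℝ} {ν : Fin n → ℝ} {v : ℝ}
    (hv : ∀ (W₁ : Matrix (Fin d) (Fin m₁) ℝ) (w₂ : EuclideanSpace ℝ (Fin m₁)),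
      ‖W₁‖ ≤ 1 → ‖w₂‖ ≤ 1 → |ν ⬝ᵥ feature X W₁ w₂| ≤ v)
    (W₁ : Matrix (Fin d) (Fin m₁) ℝ) (w₂ : EuclideanSpace ℝ (Fin m₁)) :
    |ν ⬝ᵥ feature X W₁ w₂| ≤ ‖W₁‖ * ‖w₂‖ * v := by
  rw [feature_eq_norm_smul, dotProduct_smul, smul_eq_mul, abs_mul,
    abs_of_nonneg (by positivity : 0 ≤ ‖W₁‖ * ‖w₂‖)]
  exact mul_le_mul_of_nonneg_left
    (hv _ _ (norm_inv_norm_smul_le_one _) (norm_inv_norm_smul_le_one _)) (by positivity)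

theorem norm_sq_eq_sum_column (W : Matrix (Fin d) (Fin m₁) ℝ) :
    ‖W‖ ^ 2 = ∑ k, ‖column W k‖ ^ 2 := by
  rw [Matrix.frobenius_norm_def]
  have h0 : 0 ≤ ∑ i, ∑ j, ‖W i j‖ ^ (2 : ℝ) := by positivity
  rw [← Real.sqrt_eq_rpow, Real.sq_sqrt h0, Finset.sum_comm]
  refine Finset.sum_congr rfl fun k _ => ?_
  rw [EuclideanSpace.norm_sq_eq]
  simp [column]

/-! ### Networks and the path cost -/

/-- `∑ᵢ |αᵢ| ‖W₁ᵢ‖ ‖w₂ᵢ‖`, the least cost among the layerwise rescalings of a network. -/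
noncomputable def pathCost {m : ℕ} (θ : Fin m → Branch d m₁) : ℝ :=
  ∑ i, |(θ i).α| * (‖(θ i).W₁‖ * ‖(θ i).w₂‖)

theorem pathCost_nonneg {m : ℕ} (θ : Fin m → Branch d m₁) : 0 ≤ pathCost θ := by
  unfold pathCost
  positivity

/-- `a³ + b³ + c³ - 3abc` is half of `(a + b + c)((a - b)² + (b - c)² + (a - c)²)`; the equality
case below uses the same identity. -/
theorem mul_le_sum_cubes {a b c : ℝ} (ha : 0 ≤ a) (hb : 0 ≤ b) (hc : 0 ≤ c) :
    c * (a * b) ≤ (1 / 3) * (a ^ 3 + b ^ 3 + c ^ 3) := by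
  nlinarith [mul_nonneg (add_nonneg (add_nonneg ha hb) hc)
    (add_nonneg (add_nonneg (sq_nonneg (a - b)) (sq_nonneg (b - c))) (sq_nonneg (a - c)))]

theorem eq_of_sum_cubes_le_mul {a b c : ℝ} (ha : 0 ≤ a) (hb : 0 ≤ b) (hc : 0 ≤ c)
    (h : (1 / 3) * (a ^ 3 + b ^ 3 + c ^ 3) ≤ c * (a * b)) : a = b ∧ b = c := by
  have key : (a + b + c) * ((a - b) ^ 2 + (b - c) ^ 2 + (a - c) ^ 2) ≤ 0 := by nlinarith
  rcases (add_nonneg (add_nonneg ha hb) hc).eq_or_lt with h0 | h0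
  · constructor <;> linarith
  · have h1 : (a - b) ^ 2 + (b - c) ^ 2 + (a - c) ^ 2 ≤ 0 := nonpos_of_mul_nonpos_right key h0
    have h2 : (a - b) ^ 2 = 0 := by
      linarith [sq_nonneg (a - b), sq_nonneg (b - c), sq_nonneg (a - c)]
    have h3 : (b - c) ^ 2 = 0 := by
      linarith [sq_nonneg (a - b), sq_nonneg (b - c), sq_nonneg (a - c)]
    exact ⟨sub_eq_zero.1 (pow_eq_zero_iff two_ne_zero |>.1 h2),
      sub_eq_zero.1 (pow_eq_zero_iff two_ne_zero |>.1 h3)⟩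

/-- Rescaling the layers of each branch turns the path cost into the cost. -/
theorem exists_cost_le_pathCost {X : Matrix (Fin n) (Fin d) ℝ} {y : Fin n → ℝ} {m : ℕ}
    {θ : Fin m → Branch d m₁} (h : Interpolates X y θ) :
    ∃ θ' : Fin m → Branch d m₁, Interpolates X y θ' ∧ cost θ' ≤ pathCost θ := by
  have branch (b : Branch d m₁) : ∃ b' : Branch d m₁,
      b'.α • feature X b'.W₁ b'.w₂ = b.α • feature X b.W₁ b.w₂ ∧
      (1 / 3) * (‖b'.W₁‖ ^ 3 + ‖b'.w₂‖ ^ 3 + |b'.α| ^ 3) ≤ |b.α| * (‖b.W₁‖ * ‖b.w₂‖) := by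
    set p := |b.α| * (‖b.W₁‖ * ‖b.w₂‖) with hp
    have hp0 : 0 ≤ p := by positivity
    -- AM-GM is tight for equal norms, so each layer gets the cube root of the product as its norm.
    -- If a factor vanishes, then `t = 0` and the new branch is zero.
    set t := p ^ (1 / 3 : ℝ) with ht
    have ht0 : 0 ≤ t := Real.rpow_nonneg hp0 _
    have ht3 : t ^ 3 = p := by
      rw [ht, ← Real.rpow_natCast, ← Real.rpow_mul hp0]
      norm_num
    refine ⟨⟨t • (‖b.W₁‖⁻¹ • b.W₁), t • (‖b.w₂‖⁻¹ • b.w₂), t * SignType.sign b.α⟩, ?_, ?_⟩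
    · dsimp only
      rw [feature_smul_left _ _ _ ht0, feature_smul_right _ _ _ ht0,
        feature_eq_norm_smul X b.W₁ b.w₂, smul_smul, smul_smul, smul_smul]
      congr 1
      linear_combination (SignType.sign b.α : ℝ) * (ht3.trans hp) +
        ‖b.W₁‖ * ‖b.w₂‖ * sign_mul_abs b.α
    · dsimp only
      have h1 : ‖t • (‖b.W₁‖⁻¹ • b.W₁)‖ ≤ t := by
        rw [norm_smul, Real.norm_of_nonneg ht0]
        exact mul_le_of_le_one_right ht0 (norm_inv_norm_smul_le_one _)
      have h2 : ‖t • (‖b.w₂‖⁻¹ • b.w₂)‖ ≤ t := by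
        rw [norm_smul, Real.norm_of_nonneg ht0]
        exact mul_le_of_le_one_right ht0 (norm_inv_norm_smul_le_one _)
      have h3 : |t * (SignType.sign b.α : ℝ)| ≤ t := by
        rw [abs_mul, abs_of_nonneg ht0]
        refine mul_le_of_le_one_right ht0 ?_
        rcases lt_trichotomy b.α 0 with h | h | h <;> simp [h]
      have h1' := pow_le_pow_left₀ (norm_nonneg _) h1 3
      have h2' := pow_le_pow_left₀ (norm_nonneg _) h2 3
      have h3' := pow_le_pow_left₀ (abs_nonneg _) h3 3
      linarith
  choose f hf hf' using branch
  refine ⟨fun i => f (θ i), ?_, ?_⟩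
  · unfold Interpolates at h ⊢
    simpa only [hf] using h
  · unfold cost pathCost
    rw [Finset.mul_sum]
    exact Finset.sum_le_sum fun i _ => hf' (θ i)

theorem dotProduct_branch_le {X : Matrix (Fin n) (Fin d) ℝ} {ν : Fin n → ℝ}
    (hν : DualFeasible m₁ X ν) (b : Branch d m₁) :
    ν ⬝ᵥ (b.α • feature X b.W₁ b.w₂) ≤ |b.α| * (‖b.W₁‖ * ‖b.w₂‖) := by
  rw [dotProduct_smul, smul_eq_mul]
  refine (le_abs_self _).trans ?_
  rw [abs_mul]
  refine mul_le_mul_of_nonneg_left ?_ (abs_nonneg _)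
  simpa using abs_dotProduct_feature_le hν b.W₁ b.w₂

theorem dotProduct_eq_sum {X : Matrix (Fin n) (Fin d) ℝ} {y : Fin n → ℝ} {m : ℕ}
    {θ : Fin m → Branch d m₁} (h : Interpolates X y θ) (ν : Fin n → ℝ) :
    ν ⬝ᵥ y = ∑ i, ν ⬝ᵥ ((θ i).α • feature X (θ i).W₁ (θ i).w₂) := by
  rw [← dotProduct_sum, h]

theorem dotProduct_le_pathCost {X : Matrix (Fin n) (Fin d) ℝ} {y ν : Fin n → ℝ}
    (hν : DualFeasible m₁ X ν) {m : ℕ} {θ : Fin m → Branch d m₁} (h : Interpolates X y θ) :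
    ν ⬝ᵥ y ≤ pathCost θ := by
  rw [dotProduct_eq_sum h]
  exact Finset.sum_le_sum fun i _ => dotProduct_branch_le hν (θ i)

theorem interpolates_append {X : Matrix (Fin n) (Fin d) ℝ} {y y' : Fin n → ℝ} {m m' : ℕ}
    {θ : Fin m → Branch d m₁} {θ' : Fin m' → Branch d m₁} (h : Interpolates X y θ)
    (h' : Interpolates X y' θ') : Interpolates X (y + y') (Fin.append θ θ') := by
  unfold Interpolates at *
  simp [Fin.sum_univ_add, h, h']

theorem pathCost_append {m m' : ℕ} (θ : Fin m → Branch d m₁) (θ' : Fin m' → Branch d m₁) :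
    pathCost (Fin.append θ θ') = pathCost θ + pathCost θ' := by
  simp [pathCost, Fin.sum_univ_add]

/-- Multiply the output layer of a network by a scalar. -/
def scaleOutput (c : ℝ) {m : ℕ} (θ : Fin m → Branch d m₁) : Fin m → Branch d m₁ :=
  fun i => ⟨(θ i).W₁, (θ i).w₂, c * (θ i).α⟩

theorem interpolates_scaleOutput (c : ℝ) {X : Matrix (Fin n) (Fin d) ℝ} {y : Fin n → ℝ} {m : ℕ}
    {θ : Fin m → Branch d m₁} (h : Interpolates X y θ) :
    Interpolates X (c • y) (scaleOutput c θ) := by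
  unfold Interpolates at *
  simp only [scaleOutput, mul_smul]
  rw [← Finset.smul_sum, h]

theorem pathCost_scaleOutput (c : ℝ) {m : ℕ} (θ : Fin m → Branch d m₁) :
    pathCost (scaleOutput c θ) = |c| * pathCost θ := by
  simp [pathCost, scaleOutput, Finset.mul_sum, abs_mul, mul_assoc]

/-! ### The variation norm and strong duality -/

/-- The vectors of labels that some network interpolates. -/
def interpolable (m₁ : ℕ) (X : Matrix (Fin n) (Fin d) ℝ) : Submodule ℝ (Fin n → ℝ) where
  carrier := {y | ∃ (m : ℕ) (θ : Fin m → Branch d m₁), Interpolates X y θ}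
  zero_mem' := ⟨0, Fin.elim0, by simp [Interpolates]⟩
  add_mem' := by
    rintro _ _ ⟨m, θ, h⟩ ⟨m', θ', h'⟩
    exact ⟨_, _, interpolates_append h h'⟩
  smul_mem' := by
    rintro c _ ⟨m, θ, h⟩
    exact ⟨_, _, interpolates_scaleOutput c h⟩

/-- The path costs of the networks that interpolate `y`. -/
def pathCosts (m₁ : ℕ) (X : Matrix (Fin n) (Fin d) ℝ) (y : Fin n → ℝ) : Set ℝ :=
  {c | ∃ (m : ℕ) (θ : Fin m → Branch d m₁), Interpolates X y θ ∧ pathCost θ = c}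

/-- The infimum of the path costs of the networks that interpolate `y`. -/
noncomputable def variationNorm (m₁ : ℕ) (X : Matrix (Fin n) (Fin d) ℝ) (y : Fin n → ℝ) : ℝ :=
  sInf (pathCosts m₁ X y)

theorem variationNorm_nonneg (X : Matrix (Fin n) (Fin d) ℝ) (y : Fin n → ℝ) :
    0 ≤ variationNorm m₁ X y := by
  refine Real.sInf_nonneg ?_
  rintro _ ⟨m, θ, -, rfl⟩
  exact pathCost_nonneg θ

theorem variationNorm_le {X : Matrix (Fin n) (Fin d) ℝ} {y : Fin n → ℝ} {m : ℕ}
    {θ : Fin m → Branch d m₁} (h : Interpolates X y θ) : variationNorm m₁ X y ≤ pathCost θ := by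
  refine csInf_le ⟨0, ?_⟩ ⟨m, θ, h, rfl⟩
  rintro _ ⟨m, θ, -, rfl⟩
  exact pathCost_nonneg θ

theorem le_variationNorm {X : Matrix (Fin n) (Fin d) ℝ} {y : Fin n → ℝ}
    (hy : y ∈ interpolable m₁ X) {c : ℝ}
    (hc : ∀ (m : ℕ) (θ : Fin m → Branch d m₁), Interpolates X y θ → c ≤ pathCost θ) :
    c ≤ variationNorm m₁ X y := by
  obtain ⟨m, θ, h⟩ := hy
  refine le_csInf ⟨_, m, θ, h, rfl⟩ ?_
  rintro _ ⟨m, θ, h, rfl⟩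
  exact hc m θ h

theorem variationNorm_add_le {X : Matrix (Fin n) (Fin d) ℝ} {y y' : Fin n → ℝ}
    (hy : y ∈ interpolable m₁ X) (hy' : y' ∈ interpolable m₁ X) :
    variationNorm m₁ X (y + y') ≤ variationNorm m₁ X y + variationNorm m₁ X y' := by
  rw [← sub_le_iff_le_add]
  refine le_variationNorm hy fun m θ h => ?_
  rw [sub_le_iff_le_add, ← sub_le_iff_le_add']
  refine le_variationNorm hy' fun m' θ' h' => ?_
  rw [sub_le_iff_le_add', ← pathCost_append]
  exact variationNorm_le (interpolates_append h h')

theorem variationNorm_smul {X : Matrix (Fin n) (Fin d) ℝ} {y : Fin n → ℝ}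
    (hy : y ∈ interpolable m₁ X) {c : ℝ} (hc : 0 < c) :
    variationNorm m₁ X (c • y) = c * variationNorm m₁ X y := by
  have key {z : Fin n → ℝ} (hz : z ∈ interpolable m₁ X) {a : ℝ} (ha : 0 < a) :
      variationNorm m₁ X (a • z) ≤ a * variationNorm m₁ X z := by
    rw [← div_le_iff₀' ha]
    refine le_variationNorm hz fun m θ h => ?_
    rw [div_le_iff₀' ha]
    have := variationNorm_le (interpolates_scaleOutput a h)
    rwa [pathCost_scaleOutput, abs_of_pos ha] at this
  refine (key hy hc).antisymm ?_
  have := key ((interpolable m₁ X).smul_mem c hy) (inv_pos.2 hc)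
  rwa [smul_smul, inv_mul_cancel₀ hc.ne', one_smul, ← div_eq_inv_mul, le_div_iff₀' hc] at this

/-- A single branch interpolates its own output. -/
theorem interpolates_single (X : Matrix (Fin n) (Fin d) ℝ) (b : Branch d m₁) :
    Interpolates X (b.α • feature X b.W₁ b.w₂) (fun _ : Fin 1 => b) := by
  simp [Interpolates]

theorem variationNorm_zero (X : Matrix (Fin n) (Fin d) ℝ) : variationNorm m₁ X 0 = 0 := by
  refine le_antisymm ?_ (variationNorm_nonneg X 0)
  have h : Interpolates X 0 (Fin.elim0 : Fin 0 → Branch d m₁) := by simp [Interpolates]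
  simpa [pathCost] using variationNorm_le h

/-- Strong duality, with attainment in the dual problem. -/
theorem exists_dualFeasible_eq_variationNorm {X : Matrix (Fin n) (Fin d) ℝ} {y : Fin n → ℝ}
    (hy : y ∈ interpolable m₁ X) :
    ∃ ν : Fin n → ℝ, DualFeasible m₁ X ν ∧ ν ⬝ᵥ y = variationNorm m₁ X y := by
  rcases eq_or_ne y 0 with rfl | hy0
  · exact ⟨0, fun W₁ w₂ _ _ => by simp, by simp [variationNorm_zero]⟩
  -- Hahn–Banach is applied on the interpolable subspace only: elsewhere the infimum is over the
  -- empty set and takes the default value `0`.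
  let V := interpolable m₁ X
  let z : V := ⟨y, hy⟩
  have hz : z ≠ 0 := fun h => hy0 (congrArg Subtype.val h)
  let N : V → ℝ := fun v => variationNorm m₁ X v
  have hom (c : ℝ) (hc : 0 < c) (v : V) : N (c • v) = c * N v := variationNorm_smul v.2 hc
  obtain ⟨g, hg, hgN⟩ := exists_extension_of_le_sublinear
    (LinearPMap.mkSpanSingleton (K := ℝ) z (N z) hz) N hom
    (fun v w => variationNorm_add_le v.2 w.2) (by
      rintro ⟨v, hv⟩
      obtain ⟨c, rfl⟩ := Submodule.mem_span_singleton.1 hv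
      rw [LinearPMap.mkSpanSingleton'_apply]
      rcases lt_or_ge 0 c with hc | hc
      · exact (hom c hc z).ge
      · exact (mul_nonpos_of_nonpos_of_nonneg hc (variationNorm_nonneg X _)).trans
          (variationNorm_nonneg X _))
  have hgz : g z = N z := by
    have := hg ⟨z, Submodule.mem_span_singleton_self z⟩
    rwa [LinearPMap.mkSpanSingleton_apply] at this
  -- Any linear extension will do: dual feasibility tests only features, and these lie in `V`.
  obtain ⟨f, hf⟩ := g.exists_extend
  have hfg (v : V) : f v = g v := LinearMap.congr_fun hf v
  let ν : Fin n → ℝ := fun a => f (Pi.single a 1)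
  have hν (v : Fin n → ℝ) : ν ⬝ᵥ v = f v := by
    conv_rhs => rw [pi_eq_sum_univ' v, map_sum]
    refine Finset.sum_congr rfl fun a _ => ?_
    rw [map_smul, smul_eq_mul, mul_comm]
  refine ⟨ν, fun W₁ w₂ hW hw => ?_, by rw [hν, hfg z, hgz]⟩
  have bound (c : ℝ) (hc : |c| = 1) : c * (ν ⬝ᵥ feature X W₁ w₂) ≤ 1 := by
    have hi := interpolates_single X ⟨W₁, w₂, c⟩
    rw [← smul_eq_mul, ← dotProduct_smul, hν, hfg ⟨_, _, _, hi⟩]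
    refine (hgN _).trans ((variationNorm_le hi).trans ?_)
    simpa [pathCost, hc] using mul_le_one₀ hW (norm_nonneg _) hw
  have h1 := bound 1 (by simp)
  have h2 := bound (-1) (by simp)
  exact abs_le.2 ⟨by linarith, by linarith⟩

/-! ### Dual optima and complementary slackness -/

theorem exists_isDualOptimal {X : Matrix (Fin n) (Fin d) ℝ} {y : Fin n → ℝ}
    (hy : y ∈ interpolable m₁ X) : ∃ ν : Fin n → ℝ, IsDualOptimal m₁ X y ν := by
  obtain ⟨ν, hν, h⟩ := exists_dualFeasible_eq_variationNorm hy
  refine ⟨ν, hν, fun ν' hν' => ?_⟩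
  rw [h]
  exact le_variationNorm hy fun m θ hθ => dotProduct_le_pathCost hν' hθ

/-- Rescaling shows that the optimal cost is at most every path cost, hence at most the variation
norm, which some dual feasible vector attains. -/
theorem IsOptimal.cost_le_dotProduct {X : Matrix (Fin n) (Fin d) ℝ} {y ν : Fin n → ℝ} {m : ℕ}
    {θ : Fin m → Branch d m₁} (hθ : IsOptimal X y θ) (hν : IsDualOptimal m₁ X y ν) :
    cost θ ≤ ν ⬝ᵥ y := by
  have hy : y ∈ interpolable m₁ X := ⟨m, θ, hθ.1⟩
  obtain ⟨ν', hν', h⟩ := exists_dualFeasible_eq_variationNorm hy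
  refine le_trans ?_ (hν.2 ν' hν')
  rw [h]
  refine le_variationNorm hy fun m' θ' h' => ?_
  obtain ⟨θ'', hi, hc⟩ := exists_cost_le_pathCost h'
  exact (hθ.2 _ _ hi).trans hc

/-- Complementary slackness. -/
theorem IsOptimal.branch_eq_zero_or_isMaximizer {X : Matrix (Fin n) (Fin d) ℝ}
    {y ν : Fin n → ℝ} {m : ℕ} {θ : Fin m → Branch d m₁} (hθ : IsOptimal X y θ)
    (hν : IsDualOptimal m₁ X y ν) (i : Fin m) :
    ((θ i).W₁ = 0 ∧ (θ i).w₂ = 0 ∧ (θ i).α = 0) ∨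
      ((θ i).W₁ ≠ 0 ∧ (θ i).w₂ ≠ 0 ∧
        IsMaximizer X ν (‖(θ i).W₁‖⁻¹ • (θ i).W₁) (‖(θ i).w₂‖⁻¹ • (θ i).w₂)) := by
  have hle (j : Fin m) : ν ⬝ᵥ ((θ j).α • feature X (θ j).W₁ (θ j).w₂) ≤
      (1 / 3) * (‖(θ j).W₁‖ ^ 3 + ‖(θ j).w₂‖ ^ 3 + |(θ j).α| ^ 3) :=
    (dotProduct_branch_le hν.1 (θ j)).trans
      (mul_le_sum_cubes (norm_nonneg _) (norm_nonneg _) (abs_nonneg _))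
  have hsum := hθ.cost_le_dotProduct hν
  rw [dotProduct_eq_sum hθ.1, cost, Finset.mul_sum] at hsum
  -- The inequality holds branch by branch and the totals agree, so it is an equality for each
  -- branch.
  have heq := (Finset.sum_eq_sum_iff_of_le fun j _ => hle j).1
    ((Finset.sum_le_sum fun j _ => hle j).antisymm hsum) i (Finset.mem_univ i)
  have hb := dotProduct_branch_le hν.1 (θ i)
  obtain ⟨h1, h2⟩ := eq_of_sum_cubes_le_mul (norm_nonneg (θ i).W₁) (norm_nonneg (θ i).w₂)
    (abs_nonneg (θ i).α) (heq ▸ hb)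
  rcases eq_or_ne (θ i).W₁ 0 with hW | hW
  · left
    rw [hW, norm_zero] at h1
    exact ⟨hW, norm_eq_zero.1 h1.symm, abs_eq_zero.1 (h2.symm.trans h1.symm)⟩
  right
  have hW0 : 0 < ‖(θ i).W₁‖ := norm_pos_iff.2 hW
  have hw : (θ i).w₂ ≠ 0 := norm_pos_iff.1 (h1 ▸ hW0)
  refine ⟨hW, hw, norm_inv_norm_smul_le_one _, norm_inv_norm_smul_le_one _, ?_⟩
  -- Feasibility caps all values at `1`, so it suffices that the normalized branch attains `1`.
  intro W' w' hW' hw'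
  refine (hν.1 W' w' hW' hw').trans ?_
  rw [feature_eq_norm_smul, smul_smul, dotProduct_smul, smul_eq_mul] at heq
  have h3 := congrArg abs heq
  rw [abs_mul, abs_mul, abs_of_nonneg (by positivity : 0 ≤ ‖(θ i).W₁‖ * ‖(θ i).w₂‖),
    abs_of_nonneg (by positivity :
      0 ≤ (1 / 3) * (‖(θ i).W₁‖ ^ 3 + ‖(θ i).w₂‖ ^ 3 + |(θ i).α| ^ 3))] at h3
  generalize |ν ⬝ᵥ feature X (‖(θ i).W₁‖⁻¹ • (θ i).W₁) (‖(θ i).w₂‖⁻¹ • (θ i).w₂)| = r at h3 ⊢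
  rw [← h2, ← h1] at h3
  have h4 : ‖(θ i).W₁‖ ^ 3 * r = ‖(θ i).W₁‖ ^ 3 * 1 := by linear_combination h3
  exact (mul_left_cancel₀ (by positivity) h4).ge

/-! ### Directions of columns -/

theorem column_smul (c : ℝ) (W : Matrix (Fin d) (Fin m₁) ℝ) (k : Fin m₁) :
    column (c • W) k = c • column W k := rfl

theorem direction_smul {c : ℝ} (hc : 0 < c) (v : EuclideanSpace ℝ (Fin d)) :
    direction (c • v) = direction v := by
  unfold direction
  rw [norm_smul, Real.norm_of_nonneg hc.le, smul_smul, mul_inv, mul_right_comm,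
    inv_mul_cancel₀ hc.ne', one_mul]

theorem optimalDirections_subset {X : Matrix (Fin n) (Fin d) ℝ} {y ν : Fin n → ℝ}
    (hν : IsDualOptimal m₁ X y ν) :
    optimalDirections m₁ X y ⊆ maximizerDirections m₁ X ν := by
  rintro u ⟨m, θ, hθ, i, k, hk, rfl⟩
  rcases hθ.branch_eq_zero_or_isMaximizer hν i with ⟨hW, -, -⟩ | ⟨hW, -, hmax⟩
  · exact absurd (by rw [hW]; rfl) hk
  · have hc : 0 < ‖(θ i).W₁‖⁻¹ := inv_pos.2 (norm_pos_iff.2 hW)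
    refine ⟨_, _, hmax, k, ?_, ?_⟩
    · rw [column_smul]
      exact smul_ne_zero hc.ne' hk
    · rw [column_smul, direction_smul hc]

/-- The empty network costs nothing, so all optimal weights vanish. This case is separate because
the dual gives no information for zero labels: `ν = 0` is then a dual optimum. -/
theorem optimalDirections_zero (X : Matrix (Fin n) (Fin d) ℝ) : optimalDirections m₁ X 0 = ∅ := by
  refine Set.eq_empty_of_forall_notMem ?_
  rintro u ⟨m, θ, hθ, i, k, hk, rfl⟩
  have h0 := hθ.2 0 Fin.elim0 (by simp [Interpolates])
  rw [show cost (Fin.elim0 : Fin 0 → Branch d m₁) = 0 by simp [cost], cost] at h0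
  have h1 := Finset.single_le_sum
    (f := fun i => ‖(θ i).W₁‖ ^ 3 + ‖(θ i).w₂‖ ^ 3 + |(θ i).α| ^ 3)
    (fun j _ => by positivity) (Finset.mem_univ i)
  have h2 : ‖(θ i).W₁‖ ^ 3 ≤ 0 := by
    have h3 : 0 ≤ ‖(θ i).w₂‖ ^ 3 := by positivity
    have h4 : 0 ≤ |(θ i).α| ^ 3 := by positivity
    linarith
  have h3 : (θ i).W₁ = 0 :=
    norm_eq_zero.1 (pow_eq_zero_iff three_ne_zero |>.1 (h2.antisymm (by positivity)))
  exact hk (by rw [h3]; rfl)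

/-! ### Positivity of the maximal value -/

/-- Features of unit-ball weights are bounded. -/
theorem exists_abs_dotProduct_feature_le (X : Matrix (Fin n) (Fin d) ℝ) (ν : Fin n → ℝ) :
    ∃ B : ℝ, ∀ (W₁ : Matrix (Fin d) (Fin m₁) ℝ) (w₂ : EuclideanSpace ℝ (Fin m₁)),
      ‖W₁‖ ≤ 1 → ‖w₂‖ ≤ 1 → |ν ⬝ᵥ feature X W₁ w₂| ≤ B := by
  have entry (A : Matrix (Fin n) (Fin m₁) ℝ) (a : Fin n) (k : Fin m₁) : |A a k| ≤ ‖A‖ := by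
    rw [← Real.norm_eq_abs]
    refine (PiLp.norm_apply_le (column A k) a).trans ?_
    refine le_of_sq_le_sq ?_ (norm_nonneg _)
    rw [norm_sq_eq_sum_column]
    exact Finset.single_le_sum (f := fun k => ‖column A k‖ ^ 2) (fun k _ => by positivity)
      (Finset.mem_univ k)
  refine ⟨∑ a, |ν a| * ∑ _k : Fin m₁, ‖X‖, fun W₁ w₂ hW hw => ?_⟩
  refine (Finset.abs_sum_le_sum_abs _ _).trans (Finset.sum_le_sum fun a _ => ?_)
  rw [abs_mul]
  refine mul_le_mul_of_nonneg_left ?_ (abs_nonneg _)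
  rw [feature_apply, abs_of_nonneg (relu_nonneg _)]
  refine (relu_le_abs _).trans ((Finset.abs_sum_le_sum_abs _ _).trans
    (Finset.sum_le_sum fun k _ => ?_))
  rw [abs_mul, abs_of_nonneg (relu_nonneg _)]
  have h1 : relu ((X * W₁) a k) ≤ ‖X‖ :=
    (relu_le_abs _).trans ((entry _ a k).trans ((Matrix.frobenius_norm_mul X W₁).trans
      (mul_le_of_le_one_right (norm_nonneg _) hW)))
  have h2 : |w₂ k| ≤ 1 := (PiLp.norm_apply_le w₂ k).trans hw
  exact (mul_le_mul h1 h2 (abs_nonneg _) (norm_nonneg _)).trans_eq (mul_one _)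

/-- The maximal value at a dual optimum of a nonzero vector of labels is positive. -/
theorem IsMaximizer.value_pos {X : Matrix (Fin n) (Fin d) ℝ} {y ν : Fin n → ℝ} (hy : y ≠ 0)
    (hν : IsDualOptimal m₁ X y ν) {W₁ : Matrix (Fin d) (Fin m₁) ℝ}
    {w₂ : EuclideanSpace ℝ (Fin m₁)} (h : IsMaximizer X ν W₁ w₂) :
    0 < |ν ⬝ᵥ feature X W₁ w₂| := by
  by_contra h0
  -- If the maximal value were zero, doubling `ν` would stay feasible, so `ν ⬝ᵥ y ≤ 0`. A small
  -- positive multiple of `y` is feasible with a positive objective, a contradiction.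
  have hfeas : DualFeasible m₁ X ((2 : ℝ) • ν) := fun W w hW hw => by
    have h1 := (h.2.2 W w hW hw).trans (not_lt.1 h0)
    rw [smul_dotProduct, smul_eq_mul, abs_mul]
    norm_num
    linarith
  have h1 := hν.2 _ hfeas
  rw [smul_dotProduct, smul_eq_mul] at h1
  obtain ⟨B, hB⟩ := exists_abs_dotProduct_feature_le (m₁ := m₁) X y
  have hC : 0 < max B 1 := lt_max_of_lt_right one_pos
  have hfeas' : DualFeasible m₁ X ((max B 1)⁻¹ • y) := fun W w hW hw => by
    rw [smul_dotProduct, smul_eq_mul, abs_mul, abs_of_pos (inv_pos.2 hC), ← div_eq_inv_mul,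
      div_le_one hC]
    exact (hB W w hW hw).trans (le_max_left _ _)
  have h2 := hν.2 _ hfeas'
  rw [smul_dotProduct, smul_eq_mul] at h2
  have h3 : 0 < y ⬝ᵥ y := (Finset.sum_nonneg fun a _ => mul_self_nonneg (y a)).lt_of_ne'
    (dotProduct_self_eq_zero.not.2 hy)
  have h4 := mul_pos (inv_pos.2 hC) h3
  linarith

/-! ### Sign patterns and finiteness -/

/-- The signs of all quantities on which the ReLUs and the absolute values act. -/
noncomputable def signature (X : Matrix (Fin n) (Fin d) ℝ) (ν : Fin n → ℝ)
    (W₁ : Matrix (Fin d) (Fin m₁) ℝ) (w₂ : EuclideanSpace ℝ (Fin m₁)) :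
    (Fin n → Fin m₁ → Bool) × (Fin m₁ → Bool) × (Fin n → Bool) × Bool :=
  (fun a k => decide (0 ≤ (X * W₁) a k), fun k => decide (0 ≤ w₂ k),
    fun a => decide (0 ≤ preactivation X W₁ w₂ a), decide (0 ≤ ν ⬝ᵥ feature X W₁ w₂))

theorem same_sign_of_decide_eq {s t : ℝ} (h : decide (0 ≤ s) = decide (0 ≤ t)) :
    (0 ≤ s ∧ 0 ≤ t) ∨ (s ≤ 0 ∧ t ≤ 0) := by
  rw [decide_eq_decide] at h
  rcases le_or_gt 0 s with hs | hs
  · exact Or.inl ⟨hs, h.1 hs⟩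
  · exact Or.inr ⟨hs.le, (lt_of_not_ge fun ht => hs.not_ge (h.2 ht)).le⟩

/-- Weights whose feature is the sum of two features with the same signature. -/
theorem exists_feature_add {X : Matrix (Fin n) (Fin d) ℝ} {ν : Fin n → ℝ}
    {W W' : Matrix (Fin d) (Fin m₁) ℝ} {w w' : EuclideanSpace ℝ (Fin m₁)}
    (hs : signature X ν W w = signature X ν W' w') :
    ∃ (U : Matrix (Fin d) (Fin m₁) ℝ) (τ : EuclideanSpace ℝ (Fin m₁)),
      ‖U‖ ^ 2 = ∑ k, ‖|w k| • column W k + |w' k| • column W' k‖ ∧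
      ‖τ‖ ^ 2 = ∑ k, ‖|w k| • column W k + |w' k| • column W' k‖ ∧
      feature X U τ = feature X W w + feature X W' w' := by
  simp only [signature, Prod.mk.injEq] at hs
  obtain ⟨hX, hw, hpre, -⟩ := hs
  set r : Fin m₁ → EuclideanSpace ℝ (Fin d) :=
    fun k => |w k| • column W k + |w' k| • column W' k with hr
  -- The common sign of `w k` and `w' k`, to be restored in the second layer.
  let σ : Fin m₁ → ℝ := fun k => if 0 ≤ w k then 1 else -1
  have hσ (k : Fin m₁) : σ k * |w k| = w k ∧ σ k * |w' k| = w' k := by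
    by_cases h : 0 ≤ w k
    · have h' : 0 ≤ w' k := (decide_eq_decide.1 (congrFun hw k)).1 h
      simp [σ, h, abs_of_nonneg h']
    · have h' : ¬ 0 ≤ w' k := fun h' => h ((decide_eq_decide.1 (congrFun hw k)).2 h')
      simp [σ, h, abs_of_neg (not_le.1 h), abs_of_neg (not_le.1 h')]
  have hσ1 (k : Fin m₁) : σ k ^ 2 = 1 := by
    by_cases h : 0 ≤ w k <;> simp [σ, h]
  -- The size of `r k` is split evenly: column `(q k)⁻¹ • r k` and weight `σ k * q k` both have
  -- squared norm `‖r k‖`. If `r k = 0`, the convention `0⁻¹ = 0` makes both vanish.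
  let q : Fin m₁ → ℝ := fun k => √‖r k‖
  have hq (k : Fin m₁) : q k ^ 2 = ‖r k‖ := Real.sq_sqrt (norm_nonneg _)
  have hq0 (k : Fin m₁) : 0 ≤ q k := Real.sqrt_nonneg _
  have hqr (k : Fin m₁) : q k • ((q k)⁻¹ • r k) = r k := by
    by_cases h : q k = 0
    · have : r k = 0 := norm_eq_zero.1 (by rw [← hq, h]; simp)
      simp [this]
    · rw [smul_smul, mul_inv_cancel₀ h, one_smul]
  let U : Matrix (Fin d) (Fin m₁) ℝ := Matrix.of fun j k => ((q k)⁻¹ • r k) j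
  let τ : EuclideanSpace ℝ (Fin m₁) := WithLp.toLp 2 fun k => σ k * q k
  have hU (a : Fin n) (k : Fin m₁) :
      q k * (X * U) a k = |w k| * (X * W) a k + |w' k| * (X * W') a k := by
    simp only [Matrix.mul_apply, Finset.mul_sum, ← Finset.sum_add_distrib]
    refine Finset.sum_congr rfl fun j _ => ?_
    have h1 : q k * U j k = |w k| * W j k + |w' k| * W' j k :=
      congrFun (congrArg WithLp.ofLp (hqr k)) j
    linear_combination X a j * h1
  refine ⟨U, τ, ?_, ?_, ?_⟩
  · rw [norm_sq_eq_sum_column]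
    refine Finset.sum_congr rfl fun k _ => ?_
    change ‖(q k)⁻¹ • r k‖ ^ 2 = ‖r k‖
    rw [norm_smul, mul_pow, norm_inv, Real.norm_of_nonneg (hq0 k), inv_pow, hq]
    by_cases h : ‖r k‖ = 0
    · simp [h]
    · field_simp
  · rw [EuclideanSpace.norm_sq_eq]
    refine Finset.sum_congr rfl fun k _ => ?_
    change ‖σ k * q k‖ ^ 2 = ‖r k‖
    rw [Real.norm_eq_abs, sq_abs, mul_pow, hσ1, one_mul, hq]
  · have hadd (a : Fin n) :
        preactivation X U τ a = preactivation X W w a + preactivation X W' w' a := by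
      unfold preactivation
      rw [← Finset.sum_add_distrib]
      refine Finset.sum_congr rfl fun k _ => ?_
      have h1 : q k * relu ((X * U) a k) =
          |w k| * relu ((X * W) a k) + |w' k| * relu ((X * W') a k) := by
        rw [← relu_mul_of_nonneg (hq0 k), ← relu_mul_of_nonneg (abs_nonneg _),
          ← relu_mul_of_nonneg (abs_nonneg _), hU, relu_add]
        rcases same_sign_of_decide_eq (congrFun (congrFun hX a) k) with ⟨h, h'⟩ | ⟨h, h'⟩
        · exact Or.inl ⟨mul_nonneg (abs_nonneg _) h, mul_nonneg (abs_nonneg _) h'⟩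
        · exact Or.inr ⟨mul_nonpos_of_nonneg_of_nonpos (abs_nonneg _) h,
            mul_nonpos_of_nonneg_of_nonpos (abs_nonneg _) h'⟩
      change relu ((X * U) a k) * (σ k * q k) = _
      linear_combination σ k * h1 + relu ((X * W) a k) * (hσ k).1 +
        relu ((X * W') a k) * (hσ k).2
    funext a
    rw [Pi.add_apply, feature_apply, feature_apply, feature_apply, hadd,
      relu_add (same_sign_of_decide_eq (congrFun hpre a))]

/-- Maximizers with the same signature have columns of the same directions. -/
theorem IsMaximizer.direction_eq {X : Matrix (Fin n) (Fin d) ℝ} {ν : Fin n → ℝ}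
    {W W' : Matrix (Fin d) (Fin m₁) ℝ} {w w' : EuclideanSpace ℝ (Fin m₁)}
    (h : IsMaximizer X ν W w) (h' : IsMaximizer X ν W' w')
    (hpos : 0 < |ν ⬝ᵥ feature X W w|) (hs : signature X ν W w = signature X ν W' w')
    {k : Fin m₁} (hk : column W k ≠ 0) (hk' : column W' k ≠ 0) :
    direction (column W k) = direction (column W' k) := by
  obtain ⟨U, τ, hU, hτ, hadd⟩ := exists_feature_add hs
  have hval : |ν ⬝ᵥ feature X W' w'| = |ν ⬝ᵥ feature X W w| :=
    (h.2.2 _ _ h'.1 h'.2.1).antisymm (h'.2.2 _ _ h.1 h.2.1)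
  -- The merged branch has absolute value twice the maximum, since both summands have the same sign.
  -- Homogeneity bounds it by `‖U‖ * ‖τ‖` times the maximum, which gives `2 ≤ ∑ k, ‖r k‖` below.
  have hbound := abs_dotProduct_feature_le h.2.2 U τ
  have hsign : |ν ⬝ᵥ feature X W w + ν ⬝ᵥ feature X W' w'| =
      |ν ⬝ᵥ feature X W w| + |ν ⬝ᵥ feature X W' w'| := by
    have h4 : decide (0 ≤ ν ⬝ᵥ feature X W w) = decide (0 ≤ ν ⬝ᵥ feature X W' w') := by
      simp only [signature, Prod.mk.injEq] at hs
      exact hs.2.2.2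
    exact (abs_add_eq_add_abs_iff _ _).2 (same_sign_of_decide_eq h4)
  have hτU : ‖τ‖ = ‖U‖ := by rw [← sq_eq_sq₀ (norm_nonneg _) (norm_nonneg _), hU, hτ]
  rw [hadd, dotProduct_add, hsign, hval, hτU, ← sq, hU, ← two_mul] at hbound
  have hR := le_of_mul_le_mul_right hbound hpos
  have hW : ∑ k, ‖column W k‖ ^ 2 ≤ 1 := by
    rw [← norm_sq_eq_sum_column]
    exact pow_le_one₀ (norm_nonneg _) h.1
  have hW' : ∑ k, ‖column W' k‖ ^ 2 ≤ 1 := by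
    rw [← norm_sq_eq_sum_column]
    exact pow_le_one₀ (norm_nonneg _) h'.1
  have hw : ∑ k, |w k| ^ 2 ≤ 1 := by
    have := EuclideanSpace.norm_sq_eq w
    simp only [Real.norm_eq_abs] at this
    rw [← this]
    exact pow_le_one₀ (norm_nonneg _) h.2.1
  have hw' : ∑ k, |w' k| ^ 2 ≤ 1 := by
    have := EuclideanSpace.norm_sq_eq w'
    simp only [Real.norm_eq_abs] at this
    rw [← this]
    exact pow_le_one₀ (norm_nonneg _) h'.2.1
  -- The AM-GM bound for `|w k| * ‖column W k‖ + |w' k| * ‖column W' k‖`; its sum is at most `2` by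
  -- the four unit-ball constraints.
  let M : Fin m₁ → ℝ := fun k =>
    (‖column W k‖ ^ 2 + |w k| ^ 2 + (‖column W' k‖ ^ 2 + |w' k| ^ 2)) / 2
  have hM : ∑ k, M k ≤ 2 := by
    simp only [M, ← Finset.sum_div, Finset.sum_add_distrib]
    linarith
  have htri (k : Fin m₁) : ‖|w k| • column W k + |w' k| • column W' k‖ ≤
      |w k| * ‖column W k‖ + |w' k| * ‖column W' k‖ := by
    refine (norm_add_le _ _).trans_eq ?_
    rw [norm_smul, norm_smul, Real.norm_eq_abs, Real.norm_eq_abs, abs_abs, abs_abs]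
  have hle (k : Fin m₁) : ‖|w k| • column W k + |w' k| • column W' k‖ ≤ M k := by
    refine (htri k).trans ?_
    have h1 := sq_nonneg (‖column W k‖ - |w k|)
    have h2 := sq_nonneg (‖column W' k‖ - |w' k|)
    simp only [M]
    linarith
  have heq := (Finset.sum_eq_sum_iff_of_le fun k _ => hle k).1
    ((Finset.sum_le_sum fun k _ => hle k).antisymm (hM.trans hR)) k (Finset.mem_univ k)
  have htk := htri k
  -- Equality in AM-GM balances each column against its output weight, so nonzero columns have
  -- nonzero weights; equality in the triangle inequality then puts both on one ray.
  have hsq : (‖column W k‖ - |w k|) ^ 2 + (‖column W' k‖ - |w' k|) ^ 2 ≤ 0 := by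
    simp only [M] at heq
    linarith
  have e1 : ‖column W k‖ = |w k| := by
    refine sub_eq_zero.1 (pow_eq_zero_iff two_ne_zero |>.1 ?_)
    linarith [sq_nonneg (‖column W k‖ - |w k|), sq_nonneg (‖column W' k‖ - |w' k|)]
  have e2 : ‖column W' k‖ = |w' k| := by
    refine sub_eq_zero.1 (pow_eq_zero_iff two_ne_zero |>.1 ?_)
    linarith [sq_nonneg (‖column W k‖ - |w k|), sq_nonneg (‖column W' k‖ - |w' k|)]
  have p1 : 0 < |w k| := e1 ▸ norm_pos_iff.2 hk
  have p2 : 0 < |w' k| := e2 ▸ norm_pos_iff.2 hk'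
  have hray : SameRay ℝ (|w k| • column W k) (|w' k| • column W' k) := by
    rw [sameRay_iff_norm_add, norm_smul, norm_smul, Real.norm_eq_abs, Real.norm_eq_abs, abs_abs,
      abs_abs, heq]
    simp only [M, e1, e2]
    ring
  rw [← direction_smul p1, ← direction_smul p2 (column W' k)]
  exact hray.inv_norm_smul_eq (smul_ne_zero p1.ne' hk) (smul_ne_zero p2.ne' hk')

theorem finite_maximizerDirections {X : Matrix (Fin n) (Fin d) ℝ} {y ν : Fin n → ℝ} (hy : y ≠ 0)
    (hν : IsDualOptimal m₁ X y ν) : (maximizerDirections m₁ X ν).Finite := by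
  have hmem (u : maximizerDirections m₁ X ν) := u.2
  choose W w hmax k hk hu using hmem
  -- One maximizer and one column are chosen per direction; sign pattern and column index range over
  -- a finite type.
  refine Finite.of_injective (fun u => (signature X ν (W u) (w u), k u)) ?_
  intro u u' huu
  obtain ⟨hs, hkk⟩ := Prod.mk.inj huu
  apply Subtype.ext
  rw [hu u, hu u', hkk]
  exact (hmax u).direction_eq (hmax u') ((hmax u).value_pos hy hν) hs (hkk ▸ hk u) (hk u')

theorem finite_optimalDirections (X : Matrix (Fin n) (Fin d) ℝ) (y : Fin n → ℝ) :
    (optimalDirections m₁ X y).Finite := by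
  rcases eq_or_ne y 0 with rfl | hy
  · rw [optimalDirections_zero]
    exact Set.finite_empty
  rcases (optimalDirections m₁ X y).eq_empty_or_nonempty with h | ⟨_, m, θ, hθ, -⟩
  · rw [h]
    exact Set.finite_empty
  obtain ⟨ν, hν⟩ := exists_isDualOptimal (m₁ := m₁) ⟨m, θ, hθ.1⟩
  exact (finite_maximizerDirections hy hν).subset (optimalDirections_subset hν)

end ParallelReLU

theorem theoremt5 (n d m₁ : ℕ) (X : Matrix (Fin n) (Fin d) ℝ) (y : Fin n → ℝ) :
    -- finitely many directions of the columns of optimal first-layer weights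
    (ParallelReLU.optimalDirections m₁ X y).Finite ∧
    -- a dual optimum exists as soon as the training problem is feasible
    ((∃ (m : ℕ) (θ : Fin m → ParallelReLU.Branch d m₁), ParallelReLU.Interpolates X y θ) →
      ∃ ν : Fin n → ℝ, ParallelReLU.IsDualOptimal m₁ X y ν) ∧
    -- every dual optimum determines the directions
    (∀ ν : Fin n → ℝ, ParallelReLU.IsDualOptimal m₁ X y ν →
      (∀ (m : ℕ) (θ : Fin m → ParallelReLU.Branch d m₁), ParallelReLU.IsOptimal X y θ →
        ∀ i : Fin m,
          ((θ i).W₁ = 0 ∧ (θ i).w₂ = 0 ∧ (θ i).α = 0) ∨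
          ((θ i).W₁ ≠ 0 ∧ (θ i).w₂ ≠ 0 ∧
            ParallelReLU.IsMaximizer X ν
              (‖(θ i).W₁‖⁻¹ • (θ i).W₁) (‖(θ i).w₂‖⁻¹ • (θ i).w₂))) ∧
      ParallelReLU.optimalDirections m₁ X y ⊆ ParallelReLU.maximizerDirections m₁ X ν ∧
      (y ≠ 0 → (ParallelReLU.maximizerDirections m₁ X ν).Finite)) :=
  ⟨ParallelReLU.finite_optimalDirections X y, ParallelReLU.exists_isDualOptimal,
    fun _ hν => ⟨fun _ _ hθ i => hθ.branch_eq_zero_or_isMaximizer hν i,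
      ParallelReLU.optimalDirections_subset hν,
      fun hy => ParallelReLU.finite_maximizerDirections hy hν⟩⟩
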